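/- **Theorem 1 (Golden point of probabilistic purification).** Let $d\ge 1$ and $\delta\in[0,1]$. For an operator $\rho$ on $\mathbb C^d$ let $\mathcal N_\delta(\rho)=(1-\delta)\rho+\frac{\delta}{d}\operatorname{tr}(\rho)I$ be the depolarizing channel. For a completely positive trace-non-increasing map $\mathcal E$ from operators on $(\mathbb C^d)^{\otimes 2}$ to operators on $\mathbb C^d$, and for a unit vector with projector $\psi$, put $\sigma_\psi=\mathcal E(\mathcal N_\delta(\psi)^{\otimes 2})$. Its success probability and universal fidelity are $$\mathrm{prob}(\mathcal E)=\int \operatorname{tr}[\sigma_\psi]\,d\psi,\qquad \mathrm{fid}(\mathcal E)=\frac{\int \operatorname{tr}[\sigma_\psi\psi]\,d\psi}{\int\operatorname{tr}[\sigma_\psi]\,d\psi},$$ where $d\psi$ is the Haar probability measure on unit vectors and the fidelity is considered when $\mathrm{prob}(\mathcal E)>0$. Let $F_{Depo}(2,p)$ be the maximum of $\mathrm{fid}(\mathcal E)$ over all such $\mathcal E$ with $\mathrm{prob}(\mathcal E)=p$, and $P_{Depo}(2,f)$ the maximum of $\mathrm{prob}(\mathcal E)$ over all such $\mathcal E$ with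 $\mathrm{prob}(\mathcal E)>0$ and $\mathrm{fid}(\mathcal E)=f$. Let $\lambda_0=1-\frac{d-1}{d}\delta$, $\lambda_j=\frac{\delta}{d}$ for $1\le j\le d-1$, $\Lambda=\operatorname{Diag}(\lambda_0,\dots,\lambda_{d-1})$, and $$p_2=\tfrac12\bigl(1+\operatorname{tr}[\Lambda^2]\bigr),\qquad f_2=\frac{\lambda_0+\lambda_0^2}{2p_2}.$$ Then the maximum defining $F_{Depo}(2,p_2)$ exists and $$F_{Depo}(2,p_2)=f_2,$$ and, if $\delta<1$, the maximum defining $P_{Depo}(2,f_2)$ exists and $$P_{Depo}(2,f_2)=p_2.$$ Both values are attained by the swap-test protocol $\rho\mapsto\operatorname{tr}_2[\Pi_2\rho\,\Pi_2]$, where $\Pi_2$ is the projector onto the symmetric subspace of $(\mathbb C^d)^{\otimes 2}$: this map is completely positive and trace-non-increasing, with success probability $p_2$ and universal fidelity $f_2$. Moreover, with $Q_2=\int\mathcal N_\delta(\psi)^{\otimes 2}\otimes\psi\,d\psi$, $R_2=\int\mathcal N_\delta(\psi)^{\otimes 2}\otimes I\,d\psi$ and $T_3$ the partial transpose on the third tensor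 factor, one has $f_2R_2-Q_2^{T_3}\ge 0$. -/

import Mathlib

open MeasureTheory
open scoped Kronecker ComplexOrder

namespace Purification

noncomputable section

/-- The Hilbert space of a `d`-dimensional quantum system. -/
abbrev Hil (d : ℕ) := EuclideanSpace ℂ (Fin d)

/-- Unit vectors of the `d`-dimensional system. -/
abbrev UnitVec (d : ℕ) := Metric.sphere (0 : Hil d) 1

/-- The Haar (unitarily invariant, uniform) probability measure on the unit vectors: the
surface measure of the sphere, normalized to total mass one. -/
def haarUnit (d : ℕ) : Measure (UnitVec d) :=
  ((Measure.addHaar : Measure (Hil d)).toSphere Set.univ)⁻¹ •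
    (Measure.addHaar : Measure (Hil d)).toSphere

/-- Operators on one system, in the computational basis. -/
abbrev Op (d : ℕ) := Matrix (Fin d) (Fin d) ℂ

/-- Operators on `n` copies of the system; basis vectors of the `n`-fold tensor power are indexed
by the functions `Fin n → Fin d`. -/
abbrev OpN (n d : ℕ) := Matrix (Fin n → Fin d) (Fin n → Fin d) ℂ

/-- The rank-one projector `|ψ⟩⟨ψ|`. -/
def pureState {d : ℕ} (ψ : UnitVec d) : Op d :=
  Matrix.of fun i j => ψ.1 i * star (ψ.1 j)

/-- The `n`-fold tensor power of an operator. -/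
def tensorPow {d : ℕ} (n : ℕ) (M : Op d) : OpN n d :=
  Matrix.of fun x y => ∏ k, M (x k) (y k)

/-- The ampliation `id_k ⊗ Φ` of a linear map between matrix algebras. -/
def ampliation {m n : Type} (k : ℕ) (Φ : Matrix m m ℂ →ₗ[ℂ] Matrix n n ℂ)
    (X : Matrix (Fin k × m) (Fin k × m) ℂ) : Matrix (Fin k × n) (Fin k × n) ℂ :=
  Matrix.of fun a b => Φ (Matrix.of fun i j => X (a.1, i) (b.1, j)) a.2 b.2

/-- Completely positive and trace non-increasing maps. -/
structure IsCPTN {m n : Type} [Fintype m] [Fintype n]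
    (Φ : Matrix m m ℂ →ₗ[ℂ] Matrix n n ℂ) : Prop where
  completelyPositive : ∀ (k : ℕ) (X : Matrix (Fin k × m) (Fin k × m) ℂ),
    X.PosSemidef → (ampliation k Φ X).PosSemidef
  trace_le : ∀ ρ : Matrix m m ℂ, ρ.PosSemidef → (Φ ρ).trace.re ≤ ρ.trace.re

/-- The unnormalized output `σ_ψ = E(N(ψ)^{⊗ n})`. -/
def output {d n : ℕ} (N : Op d →ₗ[ℂ] Op d) (E : OpN n d →ₗ[ℂ] Op d) (ψ : UnitVec d) : Op d :=
  E (tensorPow n (N (pureState ψ)))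

/-- The average success probability `∫ tr[σ_ψ] dψ`. -/
def prob {d n : ℕ} (N : Op d →ₗ[ℂ] Op d) (E : OpN n d →ₗ[ℂ] Op d) : ℝ :=
  ∫ ψ, (output N E ψ).trace.re ∂(haarUnit d)

/-- The universal fidelity `∫ tr[σ_ψ ψ] dψ / ∫ tr[σ_ψ] dψ`. -/
def fidelity {d n : ℕ} (N : Op d →ₗ[ℂ] Op d) (E : OpN n d →ₗ[ℂ] Op d) : ℝ :=
  (∫ ψ, (output N E ψ * pureState ψ).trace.re ∂(haarUnit d)) / prob N E

/-- Some CPTN protocol from `n` copies to one has success probability `p`, which is positive, and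
universal fidelity `f`. -/
def Achievable {d : ℕ} (N : Op d →ₗ[ℂ] Op d) (n : ℕ) (p f : ℝ) : Prop :=
  ∃ E : OpN n d →ₗ[ℂ] Op d, IsCPTN E ∧ 0 < prob N E ∧ prob N E = p ∧ fidelity N E = f

/-- `f` is the maximal universal fidelity `F_N(n, p)` for the given probability `p`. -/
def IsMaxFidelity {d : ℕ} (N : Op d →ₗ[ℂ] Op d) (n : ℕ) (p f : ℝ) : Prop :=
  IsGreatest {g : ℝ | Achievable N n p g} f

/-- `p` is the maximal universal probability `P_N(n, f)` for the given fidelity `f`. -/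
def IsMaxProbability {d : ℕ} (N : Op d →ₗ[ℂ] Op d) (n : ℕ) (f p : ℝ) : Prop :=
  IsGreatest {q : ℝ | Achievable N n q f} p

/-- The depolarizing channel `ρ ↦ (1 - δ) ρ + δ tr(ρ) I / d`. -/
def depolarizing (d : ℕ) (δ : ℝ) : Op d →ₗ[ℂ] Op d :=
  ((1 - δ : ℝ) : ℂ) • LinearMap.id +
    ((δ / d : ℝ) : ℂ) • (Matrix.traceLinearMap (Fin d) ℂ ℂ).smulRight (1 : Op d)

/-- The eigenvalues of a depolarized pure state. -/
def eigenval (d : ℕ) [NeZero d] (δ : ℝ) (j : Fin d) : ℝ :=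
  if j = 0 then 1 - ((d : ℝ) - 1) / d * δ else δ / d

/-- The eigenvalue matrix `Λ`. -/
def Lam (d : ℕ) [NeZero d] (δ : ℝ) : Matrix (Fin d) (Fin d) ℝ :=
  Matrix.diagonal (eigenval d δ)

/-- `p₂ = (1 + tr Λ²) / 2`. -/
def p₂ (d : ℕ) [NeZero d] (δ : ℝ) : ℝ := (1 + (Lam d δ ^ 2).trace) / 2

/-- `f₂ = (λ₀ + λ₀²) / (2 p₂)`. -/
def f₂ (d : ℕ) [NeZero d] (δ : ℝ) : ℝ :=
  (eigenval d δ 0 + eigenval d δ 0 ^ 2) / (2 * p₂ d δ)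

/-- The operator permuting the `n` tensor factors by `c`. -/
def permOp (n d : ℕ) (c : Equiv.Perm (Fin n)) : OpN n d :=
  Matrix.of fun x y => if x = y ∘ c then 1 else 0

/-- The projector `Π_n` on the symmetric subspace of the `n`-fold tensor power. -/
def symProj (n d : ℕ) : OpN n d :=
  ((n.factorial : ℂ)⁻¹) • ∑ c : Equiv.Perm (Fin n), permOp n d c

/-- The swap-test protocol on two copies: `ρ ↦ tr₂[Π₂ ρ Π₂†]`. -/
def swapTest (d : ℕ) : OpN 2 d →ₗ[ℂ] Op d where
  toFun ρ := Matrix.of fun i j => ∑ k : Fin d,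
    (symProj 2 d * ρ * (symProj 2 d).conjTranspose) ![i, k] ![j, k]
  map_add' ρ τ := by
    ext i j
    simp [Matrix.mul_add, Matrix.add_mul, Finset.sum_add_distrib]
  map_smul' a ρ := by
    ext i j
    simp [Finset.mul_sum]

/-- The entrywise Haar average of a matrix-valued function of a unit vector. -/
def average {d : ℕ} {m : Type} (G : UnitVec d → Matrix m m ℂ) : Matrix m m ℂ :=
  Matrix.of fun i j => ∫ ψ, G ψ i j ∂(haarUnit d)

/-- `Q_n = ∫ N(ψ)^{⊗ n} ⊗ ψ dψ`, on `n` input systems and one output system. -/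
def Qop {d : ℕ} (N : Op d →ₗ[ℂ] Op d) (n : ℕ) :
    Matrix ((Fin n → Fin d) × Fin d) ((Fin n → Fin d) × Fin d) ℂ :=
  average fun ψ : UnitVec d => tensorPow n (N (pureState ψ)) ⊗ₖ pureState ψ

/-- `R_n = ∫ N(ψ)^{⊗ n} ⊗ I dψ`. -/
def Rop {d : ℕ} (N : Op d →ₗ[ℂ] Op d) (n : ℕ) :
    Matrix ((Fin n → Fin d) × Fin d) ((Fin n → Fin d) × Fin d) ℂ :=
  average fun ψ : UnitVec d => tensorPow n (N (pureState ψ)) ⊗ₖ (1 : Op d)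

/-- The partial transpose on the last factor. -/
def partialTransposeLast {m n : Type} (M : Matrix (m × n) (m × n) ℂ) :
    Matrix (m × n) (m × n) ℂ :=
  Matrix.of fun a b => M (a.1, b.2) (b.1, a.2)

end

end Purification

namespace Purification

/-! Success probability and fidelity numerator are linear in the protocol: both pair `E` with a
fixed operator through `blockTrace` (the pairing with the Choi operator), namely with R and with
Q^{T₃}. This pairing is nonnegative on positive semidefinite operators because `E` is completely
positive. Positivity of f₂R − Q^{T₃} therefore bounds every fidelity by f₂.

To see this positivity, Haar moments up to order three turn Q and R into combinations of permutation
operators. Partial transposition makes the permutations that move the third factor into maximally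
entangled terms, which regroup as S S† for the symmetrized and antisymmetrized `entangler`. Since
S†S is a scalar c and S maps into the range of a projection P (Π₂ ⊗ 1 or its complement), cP − S S†
≥ 0. The number f₂ is exactly the one for which the symmetric part of f₂R − Q^{T₃} is a nonnegative
multiple of such a bracket (`sym_relation`, `certificate_eq`); on the antisymmetric part a surplus
`antisymGap` ≥ 0 remains.

For 0 < δ < 1 the surplus is positive, so fidelity f₂ forces `E` to annihilate the antisymmetric
projector in trace. The probability is then a multiple of tr E(Π₂) ≤ tr Π₂, which gives p₂. At δ = 0
the antisymmetric part of R vanishes and the same bound follows. The swap test attains both values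
by direct computation. -/

/-! ### Unitary invariance of the Haar measure on the sphere -/

/-- By uniqueness of Haar measure the pushforward is a multiple of the original, and the unit ball,
which `L` preserves, shows that the factor is 1. -/
theorem map_linearIsometryEquiv_addHaar {d : ℕ} (L : Hil d ≃ₗᵢ[ℂ] Hil d) :
    (Measure.addHaar : Measure (Hil d)).map L = Measure.addHaar := by
  set μ : Measure (Hil d) := Measure.addHaar
  let Lr : Hil d ≃L[ℝ] Hil d := (L.toContinuousLinearEquiv).restrictScalars ℝ
  have hL : (Lr : Hil d → Hil d) = L := rfl
  have hh : (μ.map L).IsAddHaarMeasure := by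
    rw [← hL]; infer_instance
  have h := Measure.isAddLeftInvariant_eq_smul (μ.map L) μ
  have hb : (μ.map L) (Metric.ball 0 1) = μ (Metric.ball 0 1) := by
    rw [Measure.map_apply L.continuous.measurable Metric.isOpen_ball.measurableSet,
      L.preimage_ball]
    simp
  rw [h] at hb
  rw [Measure.smul_apply, ENNReal.smul_def, smul_eq_mul] at hb
  have hc := (ENNReal.mul_eq_right (Metric.measure_ball_pos μ 0 one_pos).ne'
    measure_ball_lt_top.ne).1 hb
  rw [ENNReal.coe_eq_one] at hc
  rw [h, hc, one_smul]

/-- The action of a linear isometry on the unit sphere. -/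
noncomputable def sphereMap {d : ℕ} (L : Hil d ≃ₗᵢ[ℂ] Hil d) : UnitVec d ≃ₜ UnitVec d where
  toFun ψ := ⟨L ψ.1, by simp⟩
  invFun ψ := ⟨L.symm ψ.1, by simp⟩
  left_inv ψ := by simp
  right_inv ψ := by simp
  continuous_toFun := by fun_prop
  continuous_invFun := by fun_prop

open scoped Pointwise in
theorem map_sphereMap_haarUnit {d : ℕ} (L : Hil d ≃ₗᵢ[ℂ] Hil d) :
    (haarUnit d).map (sphereMap L) = haarUnit d := by
  have key : (Measure.addHaar : Measure (Hil d)).toSphere.map (sphereMap L) =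
      (Measure.addHaar : Measure (Hil d)).toSphere := by
    ext s hs
    have hm : Measurable (sphereMap L) := (sphereMap L).continuous.measurable
    rw [Measure.map_apply hm hs, Measure.toSphere_apply' _ (hm hs), Measure.toSphere_apply' _ hs]
    congr 1
    -- The sphere measure of a set is defined by the volume of the cone over it, and `L` commutes
    -- with forming cones.
    have : Set.Ioo (0 : ℝ) 1 • ((↑) '' (sphereMap L ⁻¹' s) : Set (Hil d)) =
        L ⁻¹' (Set.Ioo (0 : ℝ) 1 • ((↑) '' s : Set (Hil d))) := by
      ext v
      simp only [Set.mem_smul, Set.mem_preimage, Set.mem_image]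
      constructor
      · rintro ⟨r, hr, _, ⟨ψ, hψ, rfl⟩, rfl⟩
        exact ⟨r, hr, _, ⟨_, hψ, rfl⟩, (map_smul (L.toLinearEquiv.restrictScalars ℝ) r ψ.1).symm⟩
      · rintro ⟨r, hr, _, ⟨ψ, hψ, rfl⟩, h⟩
        refine ⟨r, hr, _, ⟨(sphereMap L).symm ψ, by simpa using hψ, rfl⟩, L.injective ?_⟩
        rw [← h]
        refine (map_smul (L.toLinearEquiv.restrictScalars ℝ) r _).trans ?_
        congr 1
        exact L.apply_symm_apply _
    rw [this]
    conv_rhs => rw [← map_linearIsometryEquiv_addHaar L]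
    have := (L.toHomeomorph.toMeasurableEquiv.map_apply (μ := (Measure.addHaar : Measure (Hil d)))
      (Set.Ioo (0 : ℝ) 1 • ((↑) '' s : Set (Hil d))))
    exact this.symm
  rw [haarUnit, Measure.map_smul, key]

theorem integral_sphereMap {d : ℕ} (L : Hil d ≃ₗᵢ[ℂ] Hil d) (f : UnitVec d → ℂ) :
    ∫ ψ, f (sphereMap L ψ) ∂(haarUnit d) = ∫ ψ, f ψ ∂(haarUnit d) := by
  conv_rhs => rw [← map_sphereMap_haarUnit L]
  exact ((sphereMap L).measurableEmbedding.integral_map f).symm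

instance isProbabilityMeasure_haarUnit (d : ℕ) [NeZero d] : IsProbabilityMeasure (haarUnit d) := by
  constructor
  have : Nontrivial (Hil d) := by
    have : Nonempty (Fin d) := ⟨0⟩
    infer_instance
  rw [haarUnit, Measure.smul_apply, smul_eq_mul]
  refine ENNReal.inv_mul_cancel ?_ (measure_ne_top _ _)
  rw [ne_eq, Measure.measure_univ_eq_zero]
  exact Measure.toSphere_ne_zero _

theorem integrable_of_continuous {d : ℕ} [NeZero d] {f : UnitVec d → ℂ} (hf : Continuous f) :
    Integrable f (haarUnit d) :=
  hf.integrable_of_hasCompactSupport (HasCompactSupport.of_compactSpace f)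

/-! ### Infinitesimal rotations and integration by parts -/

/-- The unitary `exp (i t |u⟩⟨u|)` for a unit vector `u`. -/
noncomputable def phaseRotation {d : ℕ} (u : Hil d) (hu : ‖u‖ = 1) (t : ℝ) :
    Hil d ≃ₗᵢ[ℂ] Hil d :=
  LinearIsometry.toLinearIsometryEquiv
    { toFun := fun v => v + ((Complex.exp (t * Complex.I) - 1) * inner ℂ u v) • u
      map_add' := fun v w => by rw [inner_add_right, mul_add, add_smul]; abel
      map_smul' := fun c v => by
        simp only [inner_smul_right, smul_add, smul_smul, RingHom.id_apply]; ring_nf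
      norm_map' := fun v => by
        set z := Complex.exp (t * Complex.I)
        set c : ℂ := inner ℂ u v
        have hz : Complex.normSq z = 1 := by
          rw [Complex.normSq_eq_norm_sq, Complex.norm_exp_ofReal_mul_I]; norm_num
        -- The cross term 2(Re z − 1)|c|² cancels |z − 1|²|c|² because |z| = 1.
        have h : ‖v + ((z - 1) * c) • u‖ ^ 2 = ‖v‖ ^ 2 := by
          have h1 : Complex.normSq (z - 1) = 2 - 2 * z.re := by
            rw [Complex.normSq_sub, hz]; simp; ring
          have h2 : RCLike.re ((z - 1) * c * (starRingEnd ℂ) c) =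
              (z.re - 1) * Complex.normSq c := by
            rw [mul_assoc, Complex.mul_conj]; simp
          rw [@norm_add_sq ℂ, norm_smul, hu, inner_smul_right,
            show (inner ℂ v u : ℂ) = (starRingEnd ℂ) c from (inner_conj_symm _ _).symm, h2,
            mul_one, ← Complex.normSq_eq_norm_sq, Complex.normSq_mul, h1]
          ring
        exact (sq_eq_sq₀ (norm_nonneg _) (norm_nonneg _)).1 h } rfl

theorem phaseRotation_apply {d : ℕ} (u : Hil d) (hu : ‖u‖ = 1) (t : ℝ) (v : Hil d) :
    phaseRotation u hu t v = v + ((Complex.exp (t * Complex.I) - 1) * inner ℂ u v) • u := rfl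

theorem inner_phaseRotation {d : ℕ} (u : Hil d) (hu : ‖u‖ = 1) (t : ℝ) (v : Hil d) :
    inner ℂ u (phaseRotation u hu t v) = Complex.exp (t * Complex.I) * inner ℂ u v := by
  rw [phaseRotation_apply, inner_add_right, inner_smul_right, inner_self_eq_norm_sq_to_K, hu]
  simp; ring

theorem hasDerivAt_phaseRotation {d : ℕ} (u : Hil d) (hu : ‖u‖ = 1) (t : ℝ) (v : Hil d)
    (i : Fin d) :
    HasDerivAt (fun s : ℝ => phaseRotation u hu s v i)
      (Complex.I * inner ℂ u (phaseRotation u hu t v) * u i) t := by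
  have h1 : HasDerivAt (fun s : ℝ => (s : ℂ) * Complex.I) Complex.I t := by
    simpa using (Complex.ofRealCLM.hasDerivAt (x := t)).mul_const Complex.I
  have h := (((h1.cexp.sub_const 1).mul_const (inner ℂ u v)).mul_const (u i)).const_add (v i)
  rw [inner_phaseRotation]
  convert! h using 1
  ring

/-- The integral over the unit sphere of an infinitesimal rotation vanishes. -/
theorem integral_deriv_eq_zero {d : ℕ} [NeZero d] (u : Hil d) (hu : ‖u‖ = 1)
    {f f' : UnitVec d → ℂ} (hf : Continuous f) (hf' : Continuous f')
    (h : ∀ (t : ℝ) (ψ : UnitVec d),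
      HasDerivAt (fun s : ℝ => f (sphereMap (phaseRotation u hu s) ψ))
        (f' (sphereMap (phaseRotation u hu t) ψ)) t) :
    ∫ ψ, f' ψ ∂(haarUnit d) = 0 := by
  obtain ⟨C, hC⟩ := isCompact_univ.exists_bound_of_continuousOn hf'.continuousOn
  have hd := hasDerivAt_integral_of_dominated_loc_of_deriv_le (μ := haarUnit d) (𝕜 := ℝ)
    (F := fun t ψ => f (sphereMap (phaseRotation u hu t) ψ)) (x₀ := 0) (s := Set.univ)
    (F' := fun t ψ => f' (sphereMap (phaseRotation u hu t) ψ)) (bound := fun _ => C)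
    Filter.univ_mem
    (.of_forall fun t =>
      (integrable_of_continuous (hf.comp (sphereMap _).continuous)).aestronglyMeasurable)
    (integrable_of_continuous (hf.comp (sphereMap _).continuous))
    (integrable_of_continuous (hf'.comp (sphereMap _).continuous)).aestronglyMeasurable
    (.of_forall fun ψ t _ => hC _ trivial) (integrable_const _)
    (.of_forall fun ψ t _ => h t ψ)
  have h2 := hd.2
  -- By invariance the integral does not depend on t, so its derivative is also 0.
  simp only [integral_sphereMap] at h2
  exact h2.unique (hasDerivAt_const _ _)

/-- Polarization: over ℂ the quadratic form determines the operator, and unit vectors suffice by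
scaling. -/
theorem sesquilinear_eq_zero {d : ℕ} (T : Fin d → Fin d → ℂ)
    (h : ∀ u : Hil d, ‖u‖ = 1 → ∑ p, ∑ q, u p * star (u q) * T p q = 0) : T = 0 := by
  have h' : ∀ u : Hil d, ∑ p, ∑ q, u p * star (u q) * T p q = 0 := by
    intro u
    rcases eq_or_ne u 0 with rfl | hu
    · simp
    have hn : ‖u‖ ≠ 0 := norm_ne_zero_iff.2 hu
    have h1 := h (((‖u‖⁻¹ : ℝ) : ℂ) • u) (by
      rw [norm_smul, Complex.norm_real, norm_inv, norm_norm, inv_mul_cancel₀ hn])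
    have h2 : ∑ p, ∑ q, u p * star (u q) * T p q = (‖u‖ : ℂ) ^ 2 *
        ∑ p, ∑ q, (((‖u‖⁻¹ : ℝ) : ℂ) • u) p * star ((((‖u‖⁻¹ : ℝ) : ℂ) • u) q) * T p q := by
      have : (‖u‖ : ℂ) ≠ 0 := by exact_mod_cast hn
      rw [Finset.mul_sum]
      refine Finset.sum_congr rfl fun p _ => ?_
      rw [Finset.mul_sum]
      refine Finset.sum_congr rfl fun q _ => ?_
      simp
      field_simp
    rw [h2, h1, mul_zero]
  have hz : Matrix.toEuclideanLin (Matrix.of fun p q => star (T p q)) = 0 := by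
    rw [← inner_map_self_eq_zero]
    intro u
    rw [← h' u, PiLp.inner_apply]
    refine Finset.sum_congr rfl fun p _ => ?_
    simp only [Matrix.toLpLin_apply, Matrix.mulVec, dotProduct, Matrix.of_apply,
      RCLike.inner_apply, map_sum, map_mul, Finset.mul_sum]
    refine Finset.sum_congr rfl fun q _ => ?_
    simp
    ring
  have hm : (Matrix.of fun p q => star (T p q)) = 0 := by simpa using hz
  ext p q
  have := congrFun (congrFun hm p) q
  simpa using this

/-- Invariance of the Haar measure under the Lie algebra of the unitary group: `f` has the
holomorphic partial derivatives `P p` and the antiholomorphic ones `Q q`. -/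
theorem integral_mul_partial_eq {d : ℕ} [NeZero d] {f : UnitVec d → ℂ}
    {P Q : Fin d → UnitVec d → ℂ} (hf : Continuous f) (hP : ∀ p, Continuous (P p))
    (hQ : ∀ q, Continuous (Q q))
    (h : ∀ (γ : ℝ → UnitVec d) (t : ℝ) (c : Fin d → ℂ),
      (∀ i, HasDerivAt (fun s => (γ s).1 i) (c i) t) →
      HasDerivAt (fun s => f (γ s))
        (∑ p, P p (γ t) * c p + ∑ q, Q q (γ t) * star (c q)) t) (p q : Fin d) :
    ∫ ψ, ψ.1 q * P p ψ ∂(haarUnit d) = ∫ ψ, star (ψ.1 p) * Q q ψ ∂(haarUnit d) := by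
  have hcoord : ∀ i, Continuous fun ψ : UnitVec d => ψ.1 i := fun i => by fun_prop
  have hi1 : ∀ p q, Integrable (fun ψ => ψ.1 q * P p ψ) (haarUnit d) := fun p q =>
    integrable_of_continuous ((hcoord q).mul (hP p))
  have hi2 : ∀ p q, Integrable (fun ψ => star (ψ.1 p) * Q q ψ) (haarUnit d) := fun p q =>
    integrable_of_continuous ((hcoord p).star.mul (hQ q))
  suffices hT : (fun p q => ∫ ψ, ψ.1 q * P p ψ ∂(haarUnit d) -
      ∫ ψ, star (ψ.1 p) * Q q ψ ∂(haarUnit d)) = (0 : Fin d → Fin d → ℂ) from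
    sub_eq_zero.1 (congrFun (congrFun hT p) q)
  refine sesquilinear_eq_zero _ fun u hu => ?_
  -- The flow of exp(it|u⟩⟨u|) has velocity i⟨u,ψ⟩u. Its derivative of `f` is thus a sesquilinear
  -- form in u, whose coefficients are the differences to be shown zero.
  have key := integral_deriv_eq_zero u hu (f := f) (f' := fun ψ =>
      ∑ p, ∑ q, Complex.I * (u p * star (u q) * (ψ.1 q * P p ψ - star (ψ.1 p) * Q q ψ))) hf
    (by fun_prop) (by
      intro t ψ
      have := h (fun s => sphereMap (phaseRotation u hu s) ψ) t _
        (fun i => hasDerivAt_phaseRotation u hu t ψ.1 i)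
      convert! this using 1
      set φ := sphereMap (phaseRotation u hu t) ψ
      have hφ : phaseRotation u hu t ψ.1 = φ.1 := rfl
      have hin : inner ℂ u φ.1 = ∑ q, star (u q) * φ.1 q := by
        rw [PiLp.inner_apply]
        exact Finset.sum_congr rfl fun q _ => by simp [mul_comm]
      rw [hφ, hin]
      simp only [star_mul', star_sum, star_star, Finset.mul_sum, Finset.sum_mul]
      rw [Finset.sum_comm (f := fun q p => Q q φ * _), ← Finset.sum_add_distrib]
      refine Finset.sum_congr rfl fun p _ => ?_
      rw [← Finset.sum_add_distrib]
      refine Finset.sum_congr rfl fun q _ => ?_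
      simp
      ring)
  rw [integral_finsetSum _ (fun p _ => integrable_of_continuous (by fun_prop))] at key
  have hI : Complex.I * ∑ p, ∑ q, u p * star (u q) * (∫ ψ, ψ.1 q * P p ψ ∂(haarUnit d) -
      ∫ ψ, star (ψ.1 p) * Q q ψ ∂(haarUnit d)) = 0 := by
    rw [← key, Finset.mul_sum]
    refine Finset.sum_congr rfl fun p _ => ?_
    rw [integral_finsetSum _ (fun q _ => integrable_of_continuous (by fun_prop)), Finset.mul_sum]
    refine Finset.sum_congr rfl fun q _ => ?_
    rw [integral_const_mul, integral_const_mul, integral_sub (hi1 p q) (hi2 p q)]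
  exact (mul_eq_zero.1 hI).resolve_left Complex.I_ne_zero

/-! ### Haar moments of order one, two and three -/

theorem sum_star_mul_self {d : ℕ} (ψ : UnitVec d) : ∑ i, ψ.1 i * star (ψ.1 i) = 1 := by
  have h : ‖ψ.1‖ ^ 2 = 1 := by simp
  rw [EuclideanSpace.norm_sq_eq] at h
  have h2 := congrArg (fun x : ℝ => (x : ℂ)) h
  simp only [Complex.ofReal_sum, Complex.ofReal_one] at h2
  rw [← h2]
  refine Finset.sum_congr rfl fun i _ => ?_
  rw [← Complex.normSq_eq_norm_sq, ← Complex.mul_conj]; rfl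

/-- The pattern for all three moments: replace the first holomorphic index by a, integrate by parts
in the pair (a, j), and sum over a. On one side the moment is multiplied by d plus the number of
remaining holomorphic factors; on the other, Σ|ψ_a|² = 1 lowers the order by one. -/
theorem integral_moment_one {d : ℕ} [NeZero d] (j m : Fin d) :
    ∫ ψ, ψ.1 j * star (ψ.1 m) ∂(haarUnit d) = if j = m then (d : ℂ)⁻¹ else 0 := by
  have hd : (d : ℂ) ≠ 0 := by exact_mod_cast NeZero.ne d
  let M : UnitVec d → ℂ := fun ψ => ψ.1 j * star (ψ.1 m)
  have hM : Continuous M := by fun_prop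
  have key : ∀ a : Fin d, ∫ ψ, M ψ ∂(haarUnit d) =
      ∫ ψ : UnitVec d, ψ.1 a * star (ψ.1 a) * (if j = m then 1 else 0) ∂(haarUnit d) := fun a => by
    have := integral_mul_partial_eq (f := fun ψ : UnitVec d => ψ.1 a * star (ψ.1 m))
      (P := fun p ψ => if p = a then star (ψ.1 m) else 0)
      (Q := fun q ψ => if q = m then ψ.1 a else 0) (by fun_prop)
      (fun p => by split_ifs <;> fun_prop) (fun q => by split_ifs <;> fun_prop)
      (fun γ t c h => by
        convert! (h a).mul (h m).star using 1
        simp [ite_mul]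
        ring) a j
    convert! this using 1
    · congr 1; ext ψ; simp only [M, if_true]
    · congr 1; ext ψ; simp only [mul_ite, mul_zero, mul_one]; congr 1; ring
  have hsum := Finset.sum_congr (rfl : (Finset.univ : Finset (Fin d)) = _) fun a _ => key a
  rw [← integral_finsetSum _ (fun a _ => integrable_of_continuous hM),
    ← integral_finsetSum _ (fun a _ => integrable_of_continuous
    (by split_ifs <;> fun_prop))] at hsum
  simp only [← Finset.sum_mul, sum_star_mul_self, one_mul, Finset.sum_const, Finset.card_univ,
    Fintype.card_fin, nsmul_eq_mul, integral_const_mul, integral_const, probReal_univ,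
    one_smul] at hsum
  rw [← mul_right_inj' hd]
  refine hsum.trans ?_
  split_ifs <;> simp [hd]

theorem integral_moment_two {d : ℕ} [NeZero d] (j k m n : Fin d) :
    ∫ ψ, ψ.1 j * ψ.1 k * star (ψ.1 m) * star (ψ.1 n) ∂(haarUnit d) =
      ((if j = m then (if k = n then 1 else 0) else 0) +
       (if j = n then (if k = m then 1 else 0) else 0)) * ((d : ℂ) * (d + 1))⁻¹ := by
  have hd : (d : ℂ) ≠ 0 := by exact_mod_cast NeZero.ne d
  have hd1 : (d : ℂ) + 1 ≠ 0 := by exact_mod_cast d.succ_ne_zero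
  let M : UnitVec d → ℂ := fun ψ => ψ.1 j * ψ.1 k * star (ψ.1 m) * star (ψ.1 n)
  have hM : Continuous M := by fun_prop
  have key : ∀ a : Fin d,
      ∫ ψ : UnitVec d, (M ψ + (if a = k then M ψ else 0)) ∂(haarUnit d) =
      ∫ ψ : UnitVec d, ψ.1 a * star (ψ.1 a) * ((if j = m then ψ.1 k * star (ψ.1 n) else 0) +
        (if j = n then ψ.1 k * star (ψ.1 m) else 0)) ∂(haarUnit d) := fun a => by
    have := integral_mul_partial_eq
      (f := fun ψ : UnitVec d => ψ.1 a * ψ.1 k * star (ψ.1 m) * star (ψ.1 n))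
      (P := fun p ψ => (if p = a then ψ.1 k * star (ψ.1 m) * star (ψ.1 n) else 0) +
        (if p = k then ψ.1 a * star (ψ.1 m) * star (ψ.1 n) else 0))
      (Q := fun q ψ => (if q = m then ψ.1 a * ψ.1 k * star (ψ.1 n) else 0) +
        (if q = n then ψ.1 a * ψ.1 k * star (ψ.1 m) else 0)) (by fun_prop)
      (fun p => by split_ifs <;> fun_prop) (fun q => by split_ifs <;> fun_prop)
      (fun γ t c h => by
        convert! (((h a).mul (h k)).mul (h m).star).mul (h n).star using 1
        simp [ite_mul, add_mul, Finset.sum_add_distrib]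
        ring) a j
    convert! this using 1
    · congr 1; ext ψ; simp only [M, mul_add, mul_ite, mul_zero, if_true]
      congr 1
      · ring
      · split_ifs with h
        · rw [h]; ring
        · rfl
    · congr 1; ext ψ; simp only [mul_add, mul_ite, mul_zero]
      congr 1 <;> (congr 1; ring)
  -- The term with a = k contributes one further copy of the moment, hence the factor d + 1.
  have hsum := Finset.sum_congr (rfl : (Finset.univ : Finset (Fin d)) = _) fun a _ => key a
  rw [← integral_finsetSum _ (fun a _ => integrable_of_continuous
    (by split_ifs <;> fun_prop)), ← integral_finsetSum _ (fun a _ => integrable_of_continuous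
    (by split_ifs <;> fun_prop))] at hsum
  simp only [← Finset.sum_mul, sum_star_mul_self, one_mul, Finset.sum_add_distrib,
    Finset.sum_ite_eq', Finset.mem_univ, if_true, Finset.sum_const, Finset.card_univ,
    Fintype.card_fin, nsmul_eq_mul, ← add_one_mul, integral_const_mul] at hsum
  rw [integral_add (integrable_of_continuous (by split_ifs <;> fun_prop))
    (integrable_of_continuous (by split_ifs <;> fun_prop))] at hsum
  have hite : ∀ (c : Prop) [Decidable c] (x y : Fin d),
      ∫ ψ, (if c then ψ.1 x * star (ψ.1 y) else 0) ∂(haarUnit d) =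
        if c then (if x = y then 1 else 0) * (d : ℂ)⁻¹ else 0 := fun c _ x y => by
    by_cases h : c
    · simp only [h, if_true, integral_moment_one, ite_mul, one_mul, zero_mul]
    · simp only [h, if_false, integral_zero]
  rw [hite, hite] at hsum
  rw [← mul_right_inj' hd1]
  refine hsum.trans ?_
  have h3 : ∀ (c : Prop) [Decidable c] (x y : ℂ), (if c then x * y else 0) =
      (if c then x else 0) * y := fun c _ x y => by split_ifs <;> simp
  rw [h3, h3]
  field_simp

theorem integral_moment_three {d : ℕ} [NeZero d] (j k l m n o : Fin d) :
    ∫ ψ, ψ.1 j * ψ.1 k * ψ.1 l * star (ψ.1 m) * star (ψ.1 n) * star (ψ.1 o) ∂(haarUnit d) =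
      ((if j = m then (if k = n then (if l = o then 1 else 0) else 0) +
         (if k = o then (if l = n then 1 else 0) else 0) else 0) +
       (if j = n then (if k = m then (if l = o then 1 else 0) else 0) +
         (if k = o then (if l = m then 1 else 0) else 0) else 0) +
       (if j = o then (if k = m then (if l = n then 1 else 0) else 0) +
         (if k = n then (if l = m then 1 else 0) else 0) else 0)) *
        ((d : ℂ) * (d + 1) * (d + 2))⁻¹ := by
  have hd : (d : ℂ) ≠ 0 := by exact_mod_cast NeZero.ne d
  have hd1 : (d : ℂ) + 1 ≠ 0 := by exact_mod_cast d.succ_ne_zero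
  have hd2 : (d : ℂ) + 2 ≠ 0 := by exact_mod_cast (d + 1).succ_ne_zero
  let M : UnitVec d → ℂ := fun ψ =>
    ψ.1 j * ψ.1 k * ψ.1 l * star (ψ.1 m) * star (ψ.1 n) * star (ψ.1 o)
  have hM : Continuous M := by fun_prop
  have key : ∀ a : Fin d,
      ∫ ψ : UnitVec d, (M ψ + (if a = k then M ψ else 0) + (if a = l then M ψ else 0))
        ∂(haarUnit d) =
      ∫ ψ : UnitVec d, ψ.1 a * star (ψ.1 a) *
        ((if j = m then ψ.1 k * ψ.1 l * star (ψ.1 n) * star (ψ.1 o) else 0) +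
        (if j = n then ψ.1 k * ψ.1 l * star (ψ.1 m) * star (ψ.1 o) else 0) +
        (if j = o then ψ.1 k * ψ.1 l * star (ψ.1 m) * star (ψ.1 n) else 0))
        ∂(haarUnit d) := fun a => by
    have := integral_mul_partial_eq
      (f := fun ψ : UnitVec d =>
        ψ.1 a * ψ.1 k * ψ.1 l * star (ψ.1 m) * star (ψ.1 n) * star (ψ.1 o))
      (P := fun p ψ =>
        (if p = a then ψ.1 k * ψ.1 l * star (ψ.1 m) * star (ψ.1 n) * star (ψ.1 o) else 0) +
        (if p = k then ψ.1 a * ψ.1 l * star (ψ.1 m) * star (ψ.1 n) * star (ψ.1 o) else 0) +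
        (if p = l then ψ.1 a * ψ.1 k * star (ψ.1 m) * star (ψ.1 n) * star (ψ.1 o) else 0))
      (Q := fun q ψ =>
        (if q = m then ψ.1 a * ψ.1 k * ψ.1 l * star (ψ.1 n) * star (ψ.1 o) else 0) +
        (if q = n then ψ.1 a * ψ.1 k * ψ.1 l * star (ψ.1 m) * star (ψ.1 o) else 0) +
        (if q = o then ψ.1 a * ψ.1 k * ψ.1 l * star (ψ.1 m) * star (ψ.1 n) else 0))
      (by fun_prop)
      (fun p => by split_ifs <;> fun_prop) (fun q => by split_ifs <;> fun_prop)
      (fun γ t c h => by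
        convert! (((((h a).mul (h k)).mul (h l)).mul (h m).star).mul (h n).star).mul
          (h o).star using 1
        simp [ite_mul, add_mul, Finset.sum_add_distrib]
        ring) a j
    convert! this using 1
    · congr 1; ext ψ; simp only [M, mul_add, mul_ite, mul_zero, if_true]
      congr 1
      · congr 1
        · ring
        · split_ifs with h
          · rw [h]; ring
          · rfl
      · split_ifs with h
        · rw [h]; ring
        · rfl
    · congr 1; ext ψ; simp only [mul_add, mul_ite, mul_zero]
      congr 1
      · congr 1 <;> (congr 1; ring)
      · congr 1; ring
  -- The terms with a = k and a = l each contribute one further copy, hence the factor d + 2.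
  have hsum := Finset.sum_congr (rfl : (Finset.univ : Finset (Fin d)) = _) fun a _ => key a
  rw [← integral_finsetSum _ (fun a _ => integrable_of_continuous
    (by split_ifs <;> fun_prop)), ← integral_finsetSum _ (fun a _ => integrable_of_continuous
    (by split_ifs <;> fun_prop))] at hsum
  simp only [← Finset.sum_mul, sum_star_mul_self, one_mul, Finset.sum_add_distrib,
    Finset.sum_ite_eq', Finset.mem_univ, if_true, Finset.sum_const, Finset.card_univ,
    Fintype.card_fin, nsmul_eq_mul, ← add_one_mul, integral_const_mul] at hsum
  rw [integral_add (integrable_of_continuous (by split_ifs <;> fun_prop))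
    (integrable_of_continuous (by split_ifs <;> fun_prop)),
    integral_add (integrable_of_continuous (by split_ifs <;> fun_prop))
    (integrable_of_continuous (by split_ifs <;> fun_prop))] at hsum
  have hite : ∀ (c : Prop) [Decidable c] (x y z w : Fin d),
      ∫ ψ, (if c then ψ.1 x * ψ.1 y * star (ψ.1 z) * star (ψ.1 w) else 0) ∂(haarUnit d) =
        if c then ((if x = z then (if y = w then 1 else 0) else 0) +
          (if x = w then (if y = z then 1 else 0) else 0)) *
          ((d : ℂ) * (d + 1))⁻¹ else 0 := fun c _ x y z w => by
    by_cases h : c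
    · simp only [h, if_true, integral_moment_two]
    · simp only [h, if_false, integral_zero]
  rw [hite, hite, hite] at hsum
  rw [← mul_right_inj' hd2, show (d : ℂ) + 2 = d + 1 + 1 by ring]
  refine hsum.trans ?_
  have h3 : ∀ (c : Prop) [Decidable c] (x y : ℂ), (if c then x * y else 0) =
      (if c then x else 0) * y := fun c _ x y => by split_ifs <;> simp
  rw [h3, h3, h3]
  field_simp

/-! ### Averages of noisy copies in coordinates -/

/-- The Kronecker delta. -/
def kdelta {d : ℕ} (i j : Fin d) : ℂ := if i = j then 1 else 0

theorem op_one_apply {d : ℕ} (i j : Fin d) : (1 : Op d) i j = kdelta i j := Matrix.one_apply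

theorem pureState_apply {d : ℕ} (ψ : UnitVec d) (i j : Fin d) :
    pureState ψ i j = ψ.1 i * star (ψ.1 j) := rfl

theorem depolarizing_pureState_apply {d : ℕ} (δ : ℝ) (ψ : UnitVec d) (i j : Fin d) :
    depolarizing d δ (pureState ψ) i j =
      ((1 - δ : ℝ) : ℂ) * (ψ.1 i * star (ψ.1 j)) + ((δ / d : ℝ) : ℂ) * kdelta i j := by
  have h : (pureState ψ).trace = 1 := sum_star_mul_self ψ
  simp [depolarizing, h, pureState_apply, op_one_apply]

theorem one_fun_apply {d : ℕ} (x y : Fin 2 → Fin d) :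
    (1 : OpN 2 d) x y = kdelta (x 0) (y 0) * kdelta (x 1) (y 1) := by
  simp only [Matrix.one_apply, kdelta, funext_iff, Fin.forall_fin_two]
  split_ifs <;> simp_all

theorem symProj_two_apply {d : ℕ} (x y : Fin 2 → Fin d) :
    symProj 2 d x y = 2⁻¹ * (kdelta (x 0) (y 0) * kdelta (x 1) (y 1) +
      kdelta (x 0) (y 1) * kdelta (x 1) (y 0)) := by
  have : (Finset.univ : Finset (Equiv.Perm (Fin 2))) = {1, Equiv.swap 0 1} := by decide
  rw [symProj, this, Finset.sum_pair (by decide)]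
  simp only [permOp, Matrix.smul_apply, Matrix.add_apply, Matrix.of_apply, funext_iff,
    Fin.forall_fin_two, kdelta]
  simp only [Equiv.Perm.coe_one, id_eq, Equiv.swap_apply_left, Equiv.swap_apply_right,
    smul_eq_mul, Function.comp_apply, ite_zero_mul_ite_zero, mul_one]
  simp
  congr

theorem integral_tensorPow_depolarizing {d : ℕ} [NeZero d] (δ : ℝ) (x y : Fin 2 → Fin d) :
    ∫ ψ, tensorPow 2 (depolarizing d δ (pureState ψ)) x y ∂(haarUnit d) =
      ((1 - δ : ℝ) : ℂ) ^ 2 * ((kdelta (x 0) (y 0) * kdelta (x 1) (y 1) +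
        kdelta (x 0) (y 1) * kdelta (x 1) (y 0)) * ((d : ℂ) * (d + 1))⁻¹) +
      (2 * ((1 - δ : ℝ) : ℂ) * ((δ / d : ℝ) : ℂ) * (d : ℂ)⁻¹ + ((δ / d : ℝ) : ℂ) ^ 2) *
        (kdelta (x 0) (y 0) * kdelta (x 1) (y 1)) := by
  set b := ((1 - δ : ℝ) : ℂ)
  set a := ((δ / d : ℝ) : ℂ)
  have hpt : ∀ ψ : UnitVec d, tensorPow 2 (depolarizing d δ (pureState ψ)) x y =
      b ^ 2 * (ψ.1 (x 0) * ψ.1 (x 1) * star (ψ.1 (y 0)) * star (ψ.1 (y 1))) +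
      b * a * kdelta (x 1) (y 1) * (ψ.1 (x 0) * star (ψ.1 (y 0))) +
      b * a * kdelta (x 0) (y 0) * (ψ.1 (x 1) * star (ψ.1 (y 1))) +
      a ^ 2 * kdelta (x 0) (y 0) * kdelta (x 1) (y 1) := fun ψ => by
    simp only [tensorPow, Matrix.of_apply, Fin.prod_univ_two, depolarizing_pureState_apply]
    ring
  simp_rw [hpt]
  rw [integral_add (integrable_of_continuous (by fun_prop)) (integrable_of_continuous (by fun_prop)),
    integral_add (integrable_of_continuous (by fun_prop)) (integrable_of_continuous (by fun_prop)),
    integral_add (integrable_of_continuous (by fun_prop)) (integrable_of_continuous (by fun_prop))]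
  simp only [integral_const_mul, integral_moment_one, integral_moment_two, integral_const,
    probReal_univ, one_smul, kdelta, ite_mul, one_mul, zero_mul]
  split_ifs <;> ring

/-- These are the entries of Q. The deltas are oriented so that partial transposition, which
exchanges the roles of `i` and `j`, yields the entries of the `entangler` products. -/
theorem integral_tensorPow_depolarizing_mul {d : ℕ} [NeZero d] (δ : ℝ) (x y : Fin 2 → Fin d)
    (i j : Fin d) :
    ∫ ψ : UnitVec d, tensorPow 2 (depolarizing d δ (pureState ψ)) x y * (ψ.1 i * star (ψ.1 j))
        ∂(haarUnit d) =
      ((1 - δ : ℝ) : ℂ) ^ 2 * (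
       (kdelta (x 0) (y 0) * (kdelta (x 1) (y 1) * kdelta j i +
          kdelta (x 1) j * kdelta (y 1) i) +
        kdelta (x 0) (y 1) * (kdelta (x 1) (y 0) * kdelta j i +
          kdelta (x 1) j * kdelta (y 0) i) +
        kdelta (x 0) j * (kdelta (x 1) (y 0) * kdelta (y 1) i +
          kdelta (x 1) (y 1) * kdelta (y 0) i)) * ((d : ℂ) * (d + 1) * (d + 2))⁻¹) +
      ((1 - δ : ℝ) : ℂ) * ((δ / d : ℝ) : ℂ) * ((d : ℂ) * (d + 1))⁻¹ *
        (kdelta (x 1) (y 1) * (kdelta (x 0) (y 0) * kdelta j i +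
          kdelta (x 0) j * kdelta (y 0) i) +
        kdelta (x 0) (y 0) * (kdelta (x 1) (y 1) * kdelta j i +
          kdelta (x 1) j * kdelta (y 1) i)) +
      ((δ / d : ℝ) : ℂ) ^ 2 * (d : ℂ)⁻¹ *
        (kdelta (x 0) (y 0) * kdelta (x 1) (y 1) * kdelta j i) := by
  set b := ((1 - δ : ℝ) : ℂ)
  set a := ((δ / d : ℝ) : ℂ)
  have hpt : ∀ ψ : UnitVec d,
      tensorPow 2 (depolarizing d δ (pureState ψ)) x y * (ψ.1 i * star (ψ.1 j)) =
      b ^ 2 * (ψ.1 (x 0) * ψ.1 (x 1) * ψ.1 i * star (ψ.1 (y 0)) * star (ψ.1 (y 1)) *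
        star (ψ.1 j)) +
      b * a * kdelta (x 1) (y 1) * (ψ.1 (x 0) * ψ.1 i * star (ψ.1 (y 0)) * star (ψ.1 j)) +
      b * a * kdelta (x 0) (y 0) * (ψ.1 (x 1) * ψ.1 i * star (ψ.1 (y 1)) * star (ψ.1 j)) +
      a ^ 2 * kdelta (x 0) (y 0) * kdelta (x 1) (y 1) * (ψ.1 i * star (ψ.1 j)) :=
    fun ψ => by
      simp only [tensorPow, Matrix.of_apply, Fin.prod_univ_two, depolarizing_pureState_apply]
      ring
  simp_rw [hpt]
  rw [integral_add (integrable_of_continuous (by fun_prop)) (integrable_of_continuous (by fun_prop)),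
    integral_add (integrable_of_continuous (by fun_prop)) (integrable_of_continuous (by fun_prop)),
    integral_add (integrable_of_continuous (by fun_prop)) (integrable_of_continuous (by fun_prop))]
  have hone : ∀ k l : Fin d, (if k = l then (d : ℂ)⁻¹ else 0) = kdelta k l * (d : ℂ)⁻¹ :=
    fun k l => by rw [kdelta]; split_ifs <;> simp
  have hmul : ∀ (k l : Fin d) (z : ℂ), (if k = l then z else 0) = kdelta k l * z :=
    fun k l z => by rw [kdelta]; split_ifs <;> simp
  have hsymm : ∀ k l : Fin d, kdelta k l = kdelta l k := fun k l => by
    simp only [kdelta, eq_comm]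
  simp only [integral_const_mul, integral_moment_one, integral_moment_two, integral_moment_three,
    hmul]
  rw [hsymm i j, hsymm i (y 0), hsymm i (y 1)]
  ring

/-! ### Projections and entanglers -/

/-- A multiple `c` of a projection `P` dominates `S Sᴴ` if `S` maps into the range of `P` and
`Sᴴ S = c`. -/
theorem posSemidef_smul_sub_mul_conjTranspose {m n : Type} [Fintype m] [Fintype n]
    [DecidableEq n] {P : Matrix m m ℂ} {S : Matrix m n ℂ} {c : ℝ} (hc : 0 ≤ c)
    (hP : P.IsHermitian) (hPP : P * P = P) (hPS : P * S = S)
    (hS : S.conjTranspose * S = (c : ℂ) • 1) :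
    ((c : ℂ) • P - S * S.conjTranspose).PosSemidef := by
  have hSP : S.conjTranspose * P = S.conjTranspose := by
    have := congrArg Matrix.conjTranspose hPS
    rwa [Matrix.conjTranspose_mul, hP.eq] at this
  set X := (c : ℂ) • P - S * S.conjTranspose
  have hX : X.conjTranspose = X := by
    simp [X, hP.eq, Matrix.conjTranspose_smul]
  -- X is c times a projection, so X = c⁻¹X†X when c > 0. The case c = 0 does occur: it is the
  -- antisymmetric bracket for d = 1.
  have hXX : X.conjTranspose * X = (c : ℂ) • X := by
    rw [hX]
    simp only [X, sub_mul, mul_sub, Matrix.smul_mul, Matrix.mul_smul, hPP]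
    rw [← Matrix.mul_assoc P S, hPS, Matrix.mul_assoc S _ P, hSP, Matrix.mul_assoc S,
      ← Matrix.mul_assoc _ S, hS]
    simp only [Matrix.smul_mul, Matrix.mul_smul, Matrix.one_mul, smul_sub]
    abel
  rcases hc.eq_or_lt with rfl | hc
  · have : X = 0 := by
      rw [← Matrix.conjTranspose_mul_self_eq_zero, hXX]; simp
    rw [this]; exact .zero
  · have hX' : X = ((c⁻¹ : ℝ) : ℂ) • (X.conjTranspose * X) := by
      rw [hXX, smul_smul, ← Complex.ofReal_mul, inv_mul_cancel₀ hc.ne']; simp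
    rw [hX']
    exact (Matrix.posSemidef_conjTranspose_mul_self X).smul (by
      exact_mod_cast (inv_pos.2 hc).le)

theorem sum_fin_two_fun {d : ℕ} (f : (Fin 2 → Fin d) → ℂ) :
    ∑ x, f x = ∑ i, ∑ j, f ![i, j] := by
  rw [← Fintype.sum_prod_type', ← (finTwoArrowEquiv (Fin d)).symm.sum_comp]
  rfl

theorem kdelta_symm {d : ℕ} (i j : Fin d) : kdelta i j = kdelta j i := by
  simp only [kdelta, eq_comm]

theorem sum_kdelta_mul {d : ℕ} (i : Fin d) (f : Fin d → ℂ) : ∑ j, kdelta i j * f j = f i := by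
  simp [kdelta]

theorem sum_kdelta_mul' {d : ℕ} (i : Fin d) (f : Fin d → ℂ) : ∑ j, kdelta j i * f j = f i := by
  simp [kdelta]

theorem symProj_two_isHermitian (d : ℕ) : (symProj 2 d).IsHermitian := by
  ext x y
  rw [Matrix.conjTranspose_apply, symProj_two_apply, symProj_two_apply]
  simp only [kdelta, eq_comm]
  split_ifs <;> simp_all

theorem symProj_two_mul_apply {d : ℕ} {m : Type} (M : Matrix (Fin 2 → Fin d) m ℂ)
    (x : Fin 2 → Fin d) (j : m) :
    (symProj 2 d * M) x j = 2⁻¹ * (M x j + M ![x 1, x 0] j) := by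
  rw [Matrix.mul_apply, sum_fin_two_fun]
  simp only [symProj_two_apply, Matrix.cons_val_zero, Matrix.cons_val_one, add_mul, mul_add,
    mul_assoc, Finset.sum_add_distrib, ← Finset.mul_sum, sum_kdelta_mul]
  rw [show ![x 0, x 1] = x by ext k; fin_cases k <;> rfl]

theorem symProj_two_mul_self (d : ℕ) : symProj 2 d * symProj 2 d = symProj 2 d := by
  ext x y
  rw [symProj_two_mul_apply]
  simp only [symProj_two_apply, Matrix.cons_val_zero, Matrix.cons_val_one]
  ring

/-- Copies of the output system inside two input copies, maximally entangled with the last system: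
symmetrized for `ε = 1` and antisymmetrized for `ε = -1`. -/
def entangler (d : ℕ) (ε : ℂ) : Matrix ((Fin 2 → Fin d) × Fin d) (Fin d) ℂ :=
  Matrix.of fun a j => kdelta (a.1 0) a.2 * kdelta (a.1 1) j +
    ε * (kdelta (a.1 1) a.2 * kdelta (a.1 0) j)

theorem star_kdelta {d : ℕ} (i j : Fin d) : star (kdelta i j) = kdelta i j := by
  rw [kdelta]; split_ifs <;> simp

theorem entangler_conjTranspose_mul_self (d : ℕ) {ε : ℂ} (hε : star ε = ε) (hε2 : ε * ε = 1) :
    (entangler d ε).conjTranspose * entangler d ε = (2 * ((d : ℂ) + ε)) • 1 := by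
  ext i j
  rw [Matrix.mul_apply, Fintype.sum_prod_type, sum_fin_two_fun (d := d)]
  simp only [entangler, Matrix.conjTranspose_apply, Matrix.of_apply, Matrix.cons_val_zero,
    Matrix.cons_val_one, star_add, star_mul', star_kdelta, hε]
  have : ∀ p q r : Fin d, (kdelta p r * kdelta q i + ε * (kdelta q r * kdelta p i)) *
      (kdelta p r * kdelta q j + ε * (kdelta q r * kdelta p j)) =
      kdelta p r * (kdelta p r * (kdelta q i * kdelta q j)) +
      ε * (kdelta p r * (kdelta q r * (kdelta q i * kdelta p j))) +
      ε * (kdelta p r * (kdelta q r * (kdelta p i * kdelta q j))) +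
      ε * ε * (kdelta q r * (kdelta q r * (kdelta p i * kdelta p j))) := by
    intro p q r; ring
  have hself : ∀ k : Fin d, kdelta k k = 1 := fun k => if_pos rfl
  simp only [this, Finset.sum_add_distrib, ← Finset.mul_sum, sum_kdelta_mul, sum_kdelta_mul', hε2,
    hself, one_mul, Finset.sum_const, Finset.card_univ, Fintype.card_fin, nsmul_eq_mul,
    Matrix.smul_apply, op_one_apply, smul_eq_mul]
  ring

theorem kron_one_mul_apply {d : ℕ} {m : Type} (P : OpN 2 d)
    (S : Matrix ((Fin 2 → Fin d) × Fin d) m ℂ) (a : (Fin 2 → Fin d) × Fin d) (j : m) :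
    ((P ⊗ₖ (1 : Op d)) * S) a j = (P * Matrix.of fun x j => S (x, a.2) j) a.1 j := by
  rw [Matrix.mul_apply, Fintype.sum_prod_type, Matrix.mul_apply]
  refine Finset.sum_congr rfl fun x _ => ?_
  simp only [Matrix.kroneckerMap_apply, op_one_apply, Matrix.of_apply, mul_assoc, ← Finset.mul_sum, sum_kdelta_mul]

/-- The factor is 1 at ε = 1 and 0 at ε = −1, which places each entangler in the range of its own
projection. -/
theorem symProj_kron_mul_entangler (d : ℕ) (ε : ℂ) :
    (symProj 2 d ⊗ₖ (1 : Op d)) * entangler d ε = ((1 + ε) / 2) • entangler d 1 := by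
  ext a j
  rw [kron_one_mul_apply, symProj_two_mul_apply]
  simp only [entangler, Matrix.of_apply, Matrix.smul_apply, smul_eq_mul, Matrix.cons_val_zero,
    Matrix.cons_val_one]
  ring

theorem posSemidef_sym_bracket (d : ℕ) :
    (((2 * ((d : ℝ) + 1) : ℝ) : ℂ) • (symProj 2 d ⊗ₖ (1 : Op d)) -
      entangler d 1 * (entangler d 1).conjTranspose).PosSemidef := by
  refine posSemidef_smul_sub_mul_conjTranspose (by positivity) ?_ ?_ ?_ ?_
  · rw [Matrix.IsHermitian, Matrix.conjTranspose_kronecker, (symProj_two_isHermitian d).eq,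
      Matrix.conjTranspose_one]
  · rw [← Matrix.mul_kronecker_mul, symProj_two_mul_self, one_mul]
  · rw [symProj_kron_mul_entangler]; norm_num
  · rw [entangler_conjTranspose_mul_self d (by simp) (by simp)]; simp

theorem posSemidef_antisym_bracket (d : ℕ) [NeZero d] :
    (((2 * ((d : ℝ) - 1) : ℝ) : ℂ) • ((1 - symProj 2 d) ⊗ₖ (1 : Op d)) -
      entangler d (-1) * (entangler d (-1)).conjTranspose).PosSemidef := by
  have hd : (1 : ℝ) ≤ d := by exact_mod_cast NeZero.one_le
  refine posSemidef_smul_sub_mul_conjTranspose (by nlinarith) ?_ ?_ ?_ ?_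
  · rw [Matrix.IsHermitian, Matrix.conjTranspose_kronecker, Matrix.conjTranspose_sub,
      (symProj_two_isHermitian d).eq, Matrix.conjTranspose_one, Matrix.conjTranspose_one]
  · rw [← Matrix.mul_kronecker_mul, one_mul]
    congr 1
    rw [sub_mul, one_mul, mul_sub, symProj_two_mul_self]; simp
  · have : (1 - symProj 2 d) ⊗ₖ (1 : Op d) = 1 - symProj 2 d ⊗ₖ (1 : Op d) := by
      ext a b
      simp only [Matrix.kroneckerMap_apply, Matrix.sub_apply, sub_mul, Matrix.one_apply,
        Prod.ext_iff, ite_zero_mul_ite_zero, mul_one]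
    rw [this, Matrix.sub_mul, symProj_kron_mul_entangler]; simp
  · rw [entangler_conjTranspose_mul_self d (by simp) (by simp)]; simp [sub_eq_add_neg]

theorem posSemidef_kron_one_of_projection {d : ℕ} {P : OpN 2 d} (hP : P.IsHermitian)
    (hPP : P * P = P) : (P ⊗ₖ (1 : Op d)).PosSemidef := by
  have : P ⊗ₖ (1 : Op d) = (P ⊗ₖ (1 : Op d)).conjTranspose * (P ⊗ₖ (1 : Op d)) := by
    rw [Matrix.conjTranspose_kronecker, hP.eq, Matrix.conjTranspose_one,
      ← Matrix.mul_kronecker_mul, hPP, one_mul]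
  rw [this]
  exact Matrix.posSemidef_conjTranspose_mul_self _

/-! ### The dual certificate -/

/-- The second moment is proportional to 1 + swap = 2Π₂, so only the symmetric eigenvalue receives
the (1 − δ)² term. -/
theorem Rop_eq (d : ℕ) [NeZero d] (δ : ℝ) :
    Rop (depolarizing d δ) 2 =
      ((2 * (1 - δ) ^ 2 / (d * (d + 1)) + 2 * (1 - δ) * (δ / d) / d + (δ / d) ^ 2 : ℝ) : ℂ) •
        (symProj 2 d ⊗ₖ (1 : Op d)) +
      ((2 * (1 - δ) * (δ / d) / d + (δ / d) ^ 2 : ℝ) : ℂ) • ((1 - symProj 2 d) ⊗ₖ (1 : Op d)) := by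
  ext a b
  simp only [Rop, average, Matrix.of_apply, Matrix.kroneckerMap_apply, integral_mul_const,
    integral_tensorPow_depolarizing, Matrix.add_apply, Matrix.smul_apply, Matrix.sub_apply,
    one_fun_apply, op_one_apply, symProj_two_apply, smul_eq_mul]
  push_cast
  simp only [div_eq_mul_inv]
  ring

/-- The gap of the antisymmetric eigenvalues of the dual certificate. -/
noncomputable def antisymGap (d : ℕ) [NeZero d] (δ : ℝ) : ℝ :=
  f₂ d δ * (2 * (1 - δ) * (δ / d) / d + (δ / d) ^ 2) - δ / d * (δ / d + (1 - δ)) / d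

/-- With a = δ/d and b = 1 − δ, the diagonal of Λ is a everywhere plus b at index 0. Later
identities are polynomial in a, b and d. -/
theorem two_mul_p₂ (d : ℕ) [NeZero d] (δ : ℝ) :
    2 * p₂ d δ = 1 + (d * (δ / d) ^ 2 + 2 * (δ / d) * (1 - δ) + (1 - δ) ^ 2) := by
  have hd : (d : ℝ) ≠ 0 := by exact_mod_cast NeZero.ne d
  have h : (Lam d δ ^ 2).trace = ∑ j, eigenval d δ j ^ 2 := by
    rw [Lam, Matrix.diagonal_pow, Matrix.trace_diagonal]; rfl
  have h2 : ∑ j, eigenval d δ j ^ 2 =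
      ∑ j : Fin d, ((δ / d) ^ 2 + if j = 0 then (1 - (d - 1) / d * δ) ^ 2 - (δ / d) ^ 2 else 0) := by
    refine Finset.sum_congr rfl fun j _ => ?_
    rw [eigenval]; split_ifs <;> ring
  rw [p₂, h, h2, Finset.sum_add_distrib]
  simp
  field_simp
  ring

theorem p₂_pos (d : ℕ) [NeZero d] (δ : ℝ) : 0 < p₂ d δ := by
  have h : (Lam d δ ^ 2).trace = ∑ j, eigenval d δ j ^ 2 := by
    rw [Lam, Matrix.diagonal_pow, Matrix.trace_diagonal]; rfl
  rw [p₂, h]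
  positivity

theorem eigenval_zero (d : ℕ) [NeZero d] (δ : ℝ) : eigenval d δ 0 = δ / d + (1 - δ) := by
  have hd : (d : ℝ) ≠ 0 := by exact_mod_cast NeZero.ne d
  rw [eigenval, if_pos rfl]
  field_simp
  ring

theorem f₂_mul_two_mul_p₂ (d : ℕ) [NeZero d] (δ : ℝ) :
    f₂ d δ * (2 * p₂ d δ) = (δ / d + (1 - δ)) + (δ / d + (1 - δ)) ^ 2 := by
  rw [f₂, div_mul_cancel₀ _ (by linarith [p₂_pos d δ] : 2 * p₂ d δ ≠ 0), eigenval_zero]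

/-- The right side is the eigenvalue of Q^{T₃} on the range of the symmetric entangler, so f₂R −
Q^{T₃} vanishes there. This is what makes the fidelity bound tight. -/
theorem sym_relation (d : ℕ) [NeZero d] (δ : ℝ) :
    f₂ d δ * (2 * (1 - δ) ^ 2 / (d * (d + 1)) + 2 * (1 - δ) * (δ / d) / d + (δ / d) ^ 2) =
      2 * (1 - δ) ^ 2 / (d * (d + 1)) + (1 - δ) * (δ / d) * (d + 3) / (d * (d + 1)) +
        (δ / d) ^ 2 / d := by
  have hd : (d : ℝ) ≠ 0 := by exact_mod_cast NeZero.ne d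
  have hd1 : (d : ℝ) + 1 ≠ 0 := by exact_mod_cast d.succ_ne_zero
  have hf := f₂_mul_two_mul_p₂ d δ
  rw [two_mul_p₂] at hf
  generalize f₂ d δ = f at *
  -- Taking a = δ/d as the variable, with δ = da, avoids nested fractions.
  have ha : δ = d * (δ / d) := by field_simp
  generalize δ / d = a at *
  subst ha
  field_simp
  linear_combination hf

/-- The first coefficient collects the third moment, which is fully symmetric, and half of the mixed
term. The mixed term contains only the entangled products with matching positions; half the sum of
the ε = 1 and ε = −1 products isolates them. -/
theorem certificate_eq (d : ℕ) [NeZero d] (δ : ℝ) :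
    ((f₂ d δ : ℝ) : ℂ) • Rop (depolarizing d δ) 2 -
        partialTransposeLast (Qop (depolarizing d δ) 2) =
      (((1 - δ) ^ 2 / (d * (d + 1) * (d + 2)) + (1 - δ) * (δ / d) / (2 * (d * (d + 1))) : ℝ) : ℂ) •
        (((2 * ((d : ℝ) + 1) : ℝ) : ℂ) • (symProj 2 d ⊗ₖ (1 : Op d)) -
          entangler d 1 * (entangler d 1).conjTranspose) +
      (((1 - δ) * (δ / d) / (2 * (d * (d + 1))) : ℝ) : ℂ) •
        (((2 * ((d : ℝ) - 1) : ℝ) : ℂ) • ((1 - symProj 2 d) ⊗ₖ (1 : Op d)) -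
          entangler d (-1) * (entangler d (-1)).conjTranspose) +
      ((antisymGap d δ : ℝ) : ℂ) • ((1 - symProj 2 d) ⊗ₖ (1 : Op d)) := by
  have hd : (d : ℂ) ≠ 0 := by exact_mod_cast NeZero.ne d
  have hd1 : (d : ℂ) + 1 ≠ 0 := by exact_mod_cast d.succ_ne_zero
  have hd2 : (d : ℂ) + 2 ≠ 0 := by exact_mod_cast (d + 1).succ_ne_zero
  have hrel := congrArg (fun x : ℝ => (x : ℂ)) (sym_relation d δ)
  have hent : ∀ (ε : ℂ) (a b : (Fin 2 → Fin d) × Fin d), star ε = ε → ε * ε = 1 →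
      (entangler d ε * (entangler d ε).conjTranspose) a b =
      kdelta (a.1 0) a.2 * kdelta (b.1 0) b.2 * kdelta (a.1 1) (b.1 1) +
      ε * (kdelta (a.1 0) a.2 * kdelta (b.1 1) b.2 * kdelta (a.1 1) (b.1 0)) +
      ε * (kdelta (a.1 1) a.2 * kdelta (b.1 0) b.2 * kdelta (a.1 0) (b.1 1)) +
      kdelta (a.1 1) a.2 * kdelta (b.1 1) b.2 * kdelta (a.1 0) (b.1 0) := by
    intro ε a b h1 h2
    rw [Matrix.mul_apply]
    simp only [entangler, Matrix.conjTranspose_apply, Matrix.of_apply, star_add, star_mul',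
      star_kdelta, h1]
    have : ∀ j : Fin d, (kdelta (a.1 0) a.2 * kdelta (a.1 1) j +
        ε * (kdelta (a.1 1) a.2 * kdelta (a.1 0) j)) *
        (kdelta (b.1 0) b.2 * kdelta (b.1 1) j +
        ε * (kdelta (b.1 1) b.2 * kdelta (b.1 0) j)) =
        kdelta (a.1 1) j * (kdelta (a.1 0) a.2 * (kdelta (b.1 0) b.2 *
          kdelta (b.1 1) j)) +
        ε * (kdelta (a.1 1) j * (kdelta (a.1 0) a.2 * (kdelta (b.1 1) b.2 *
          kdelta (b.1 0) j))) +
        ε * (kdelta (a.1 0) j * (kdelta (a.1 1) a.2 * (kdelta (b.1 0) b.2 *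
          kdelta (b.1 1) j))) +
        ε * ε * (kdelta (a.1 0) j * (kdelta (a.1 1) a.2 * (kdelta (b.1 1) b.2 *
          kdelta (b.1 0) j))) := fun j => by ring
    simp only [this, Finset.sum_add_distrib, ← Finset.mul_sum, sum_kdelta_mul, h2]
    rw [kdelta_symm (b.1 1) (a.1 1), kdelta_symm (b.1 0) (a.1 1), kdelta_symm (b.1 1) (a.1 0),
      kdelta_symm (b.1 0) (a.1 0)]
    ring
  ext a b
  rw [Rop_eq]
  simp only [Matrix.add_apply, Matrix.sub_apply, Matrix.smul_apply, smul_eq_mul,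
    hent 1 a b (by simp) (by simp), hent (-1) a b (by simp) (by simp), Matrix.kroneckerMap_apply,
    symProj_two_apply, one_fun_apply, partialTransposeLast, Qop, average, Matrix.of_apply,
    pureState_apply, op_one_apply, integral_tensorPow_depolarizing_mul, antisymGap]
  push_cast at hrel ⊢
  set f := ((f₂ d δ : ℝ) : ℂ)
  set A00 := kdelta (a.1 0) (b.1 0)
  set A11 := kdelta (a.1 1) (b.1 1)
  set A01 := kdelta (a.1 0) (b.1 1)
  set A10 := kdelta (a.1 1) (b.1 0)
  set B := kdelta a.2 b.2
  set U0 := kdelta (a.1 0) a.2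
  set U1 := kdelta (a.1 1) a.2
  set W0 := kdelta (b.1 0) b.2
  set W1 := kdelta (b.1 1) b.2
  generalize (δ : ℂ) / d = α at *
  generalize 1 - (δ : ℂ) = β at *
  -- Everything else cancels identically; the residue is the entry of Π₂ ⊗ 1 times `sym_relation`.
  linear_combination (norm := (field_simp; ring)) (2⁻¹ * (A00 * A11 + A01 * A10) * B) * hrel

/-! ### Pairing with the Choi operator -/

/-- The linear functional `M ↦ ∑ i j, E(M_{ij})_{ij}` of the blocks of `M`, which pairs `M` with the
Choi operator of `E`. -/
def blockTrace {m : Type} {d : ℕ} (E : Matrix m m ℂ →ₗ[ℂ] Op d) :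
    Matrix (m × Fin d) (m × Fin d) ℂ →ₗ[ℂ] ℂ where
  toFun M := ∑ i, ∑ j, E (Matrix.of fun x y => M (x, i) (y, j)) i j
  map_add' M M' := by
    simp only [← Finset.sum_add_distrib, ← Matrix.add_apply, ← map_add]
    rfl
  map_smul' c M := by
    simp only [RingHom.id_apply, smul_eq_mul, Finset.mul_sum]
    simp only [← smul_eq_mul, ← Matrix.smul_apply, ← map_smul]
    rfl

/-- The value is ⟨Ω|(id ⊗ E)(M)|Ω⟩ for the unnormalized maximally entangled Ω = Σ|ii⟩, after moving
the ancilla to the front. -/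
theorem blockTrace_nonneg {m : Type} [Fintype m] {d : ℕ} {E : Matrix m m ℂ →ₗ[ℂ] Op d}
    (hE : IsCPTN E) {M : Matrix (m × Fin d) (m × Fin d) ℂ} (hM : M.PosSemidef) :
    0 ≤ blockTrace E M := by
  have h := ((hE.completelyPositive d _ (hM.submatrix Prod.swap)).submatrix
    (fun i : Fin d => (i, i))).dotProduct_mulVec_nonneg 1
  simpa [dotProduct, Matrix.mulVec, ampliation, blockTrace] using h

/-- The transpose appearing here is the reason for T₃ in the certificate. -/
theorem blockTrace_kronecker {m : Type} {d : ℕ} (E : Matrix m m ℂ →ₗ[ℂ] Op d)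
    (ρ : Matrix m m ℂ) (τ : Op d) :
    blockTrace E (ρ ⊗ₖ τ) = (E ρ * τ.transpose).trace := by
  simp only [Matrix.trace, Matrix.diag_apply, Matrix.mul_apply, Matrix.transpose_apply]
  change ∑ i, ∑ j, E (Matrix.of fun x y => (ρ ⊗ₖ τ) (x, i) (y, j)) i j = _
  refine Finset.sum_congr rfl fun i _ => Finset.sum_congr rfl fun j _ => ?_
  have : (Matrix.of fun x y => (ρ ⊗ₖ τ) (x, i) (y, j)) = τ i j • ρ := by
    ext x y; simp [mul_comm]
  rw [this, map_smul, Matrix.smul_apply, smul_eq_mul, mul_comm]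

theorem blockTrace_kronecker_one {m : Type} {d : ℕ} (E : Matrix m m ℂ →ₗ[ℂ] Op d)
    (ρ : Matrix m m ℂ) : blockTrace E (ρ ⊗ₖ (1 : Op d)) = (E ρ).trace := by
  rw [blockTrace_kronecker, Matrix.transpose_one, Matrix.mul_one]

theorem continuous_linear_comp {m : Type} [Fintype m] [DecidableEq m] {d : ℕ}
    (L : Matrix m m ℂ →ₗ[ℂ] ℂ) {G : UnitVec d → Matrix m m ℂ}
    (hG : ∀ a b, Continuous fun ψ => G ψ a b) : Continuous fun ψ => L (G ψ) :=
  L.continuous_of_finiteDimensional.comp (continuous_matrix hG)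

theorem linear_average {m : Type} [Fintype m] [DecidableEq m] {d : ℕ} [NeZero d]
    (L : Matrix m m ℂ →ₗ[ℂ] ℂ) {G : UnitVec d → Matrix m m ℂ}
    (hG : ∀ a b, Continuous fun ψ => G ψ a b) :
    L (average G) = ∫ ψ, L (G ψ) ∂(haarUnit d) := by
  have hL : ∀ M : Matrix m m ℂ, L M = ∑ a, ∑ b, M a b * L (Matrix.single a b 1) := fun M => by
    conv_lhs => rw [Matrix.matrix_eq_sum_single M]
    simp only [map_sum]
    refine Finset.sum_congr rfl fun a _ => Finset.sum_congr rfl fun b _ => ?_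
    rw [← smul_eq_mul, ← map_smul, Matrix.smul_single, smul_eq_mul, mul_one]
  simp_rw [hL (G _)]
  rw [hL, integral_finsetSum _ fun a _ => integrable_of_continuous (by fun_prop)]
  refine Finset.sum_congr rfl fun a _ => ?_
  rw [integral_finsetSum _ fun a _ => integrable_of_continuous (by fun_prop)]
  refine Finset.sum_congr rfl fun b _ => ?_
  rw [integral_mul_const]
  rfl

theorem continuous_pureState_apply {d : ℕ} (i j : Fin d) :
    Continuous fun ψ : UnitVec d => pureState ψ i j := by
  simp only [pureState_apply]; fun_prop

theorem continuous_tensorPow_depolarizing {d n : ℕ} (δ : ℝ) (x y : Fin n → Fin d) :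
    Continuous fun ψ : UnitVec d => tensorPow n (depolarizing d δ (pureState ψ)) x y := by
  simp only [tensorPow, Matrix.of_apply, depolarizing_pureState_apply]; fun_prop

theorem prob_eq_blockTrace {d n : ℕ} [NeZero d] (δ : ℝ) (E : OpN n d →ₗ[ℂ] Op d) :
    prob (depolarizing d δ) E = (blockTrace E (Rop (depolarizing d δ) n)).re := by
  have hG : ∀ a b, Continuous fun ψ : UnitVec d =>
      (tensorPow n (depolarizing d δ (pureState ψ)) ⊗ₖ (1 : Op d)) a b := fun a b => by
    simp only [Matrix.kroneckerMap_apply]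
    exact (continuous_tensorPow_depolarizing δ _ _).mul continuous_const
  rw [Rop, linear_average _ hG, ← RCLike.re_eq_complex_re, ← integral_re
    (integrable_of_continuous (continuous_linear_comp _ hG))]
  simp only [blockTrace_kronecker_one]
  rfl

theorem partialTransposeLast_Qop {d n : ℕ} (N : Op d →ₗ[ℂ] Op d) :
    partialTransposeLast (Qop N n) = average fun ψ : UnitVec d =>
      tensorPow n (N (pureState ψ)) ⊗ₖ (pureState ψ).transpose := rfl

theorem fidelity_numerator_eq_blockTrace {d n : ℕ} [NeZero d] (δ : ℝ)
    (E : OpN n d →ₗ[ℂ] Op d) :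
    ∫ ψ, (output (depolarizing d δ) E ψ * pureState ψ).trace.re ∂(haarUnit d) =
      (blockTrace E (partialTransposeLast (Qop (depolarizing d δ) n))).re := by
  have hG : ∀ a b, Continuous fun ψ : UnitVec d =>
      (tensorPow n (depolarizing d δ (pureState ψ)) ⊗ₖ (pureState ψ).transpose) a b :=
    fun a b => by
      simp only [Matrix.kroneckerMap_apply, Matrix.transpose_apply]
      exact (continuous_tensorPow_depolarizing δ _ _).mul (continuous_pureState_apply _ _)
  rw [partialTransposeLast_Qop, linear_average _ hG, ← RCLike.re_eq_complex_re, ← integral_re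
    (integrable_of_continuous (continuous_linear_comp _ hG))]
  simp only [blockTrace_kronecker, Matrix.transpose_transpose]
  rfl

/-! ### Sign of the gap and optimality -/

theorem trace_symProj_two (d : ℕ) : (symProj 2 d).trace = ((d * (d + 1) / 2 : ℝ) : ℂ) := by
  rw [Matrix.trace, sum_fin_two_fun]
  have hself : ∀ k : Fin d, kdelta k k = 1 := fun k => if_pos rfl
  simp only [Matrix.diag_apply, symProj_two_apply, Matrix.cons_val_zero, Matrix.cons_val_one, hself,
    ← Finset.mul_sum, Finset.sum_add_distrib, sum_kdelta_mul, Finset.sum_const, Finset.card_univ,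
    Fintype.card_fin, nsmul_eq_mul]
  push_cast
  ring

theorem one_sub_symProj_two_isHermitian (d : ℕ) : (1 - symProj 2 d).IsHermitian :=
  Matrix.isHermitian_one.sub (symProj_two_isHermitian d)

theorem one_sub_symProj_two_mul_self (d : ℕ) :
    (1 - symProj 2 d) * (1 - symProj 2 d) = 1 - symProj 2 d := by
  rw [sub_mul, one_mul, mul_sub, symProj_two_mul_self]; simp

/-- Multiplication by p₂ clears the denominator of f₂ and leaves a product whose sign is evident. -/
theorem p₂_mul_antisymGap (d : ℕ) [NeZero d] (δ : ℝ) :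
    p₂ d δ * antisymGap d δ = δ / d * (1 - δ) * (δ / d + (1 - δ)) / d := by
  have hd : (d : ℝ) ≠ 0 := by exact_mod_cast NeZero.ne d
  have hf := f₂_mul_two_mul_p₂ d δ
  have hp := two_mul_p₂ d δ
  rw [antisymGap]
  generalize f₂ d δ = f at *
  generalize p₂ d δ = p at *
  have ha : δ = d * (δ / d) := by field_simp
  generalize δ / d = a at *
  subst ha
  field_simp
  linear_combination (a * (2 - d * a) / 2) * hf - (a * (1 - (d - 1) * a) / 2) * hp

theorem antisymGap_nonneg (d : ℕ) [NeZero d] {δ : ℝ} (h0 : 0 ≤ δ) (h1 : δ ≤ 1) :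
    0 ≤ antisymGap d δ := by
  have h : 0 ≤ p₂ d δ * antisymGap d δ := by
    have : 0 ≤ 1 - δ := sub_nonneg.2 h1
    rw [p₂_mul_antisymGap]; positivity
  exact nonneg_of_mul_nonneg_right h (p₂_pos d δ)

theorem antisymGap_pos (d : ℕ) [NeZero d] {δ : ℝ} (h0 : 0 < δ) (h1 : δ < 1) :
    0 < antisymGap d δ := by
  have hd : (0 : ℝ) < d := by exact_mod_cast NeZero.pos d
  have h : 0 < p₂ d δ * antisymGap d δ := by
    have : 0 < 1 - δ := sub_pos.2 h1
    rw [p₂_mul_antisymGap]; positivity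
  exact pos_of_mul_pos_right h (p₂_pos d δ).le

theorem posSemidef_certificate_sub (d : ℕ) [NeZero d] {δ : ℝ} (h0 : 0 ≤ δ) (h1 : δ ≤ 1) :
    (((f₂ d δ : ℝ) : ℂ) • Rop (depolarizing d δ) 2 -
      partialTransposeLast (Qop (depolarizing d δ) 2) -
      ((antisymGap d δ : ℝ) : ℂ) • ((1 - symProj 2 d) ⊗ₖ (1 : Op d))).PosSemidef := by
  have hb : 0 ≤ 1 - δ := sub_nonneg.2 h1
  rw [certificate_eq, add_sub_cancel_right]
  refine ((posSemidef_sym_bracket d).smul ?_).add ((posSemidef_antisym_bracket d).smul ?_)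
  · rw [Complex.zero_le_real]; positivity
  · rw [Complex.zero_le_real]; positivity

theorem posSemidef_certificate (d : ℕ) [NeZero d] {δ : ℝ} (h0 : 0 ≤ δ) (h1 : δ ≤ 1) :
    (((f₂ d δ : ℝ) : ℂ) • Rop (depolarizing d δ) 2 -
      partialTransposeLast (Qop (depolarizing d δ) 2)).PosSemidef := by
  have h := (posSemidef_certificate_sub d h0 h1).add
    ((posSemidef_kron_one_of_projection (one_sub_symProj_two_isHermitian d)
      (one_sub_symProj_two_mul_self d)).smul
      (show (0 : ℂ) ≤ ((antisymGap d δ : ℝ) : ℂ) from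
        Complex.zero_le_real.2 (antisymGap_nonneg d h0 h1)))
  rwa [sub_add_cancel] at h

/-- Keeping the antisymmetric surplus on the left serves both bounds: its sign bounds the fidelity,
and its vanishing at equality bounds the probability. -/
theorem antisymGap_mul_trace_le {d : ℕ} [NeZero d] {δ : ℝ} (h0 : 0 ≤ δ) (h1 : δ ≤ 1)
    {E : OpN 2 d →ₗ[ℂ] Op d} (hE : IsCPTN E) :
    antisymGap d δ * (E (1 - symProj 2 d)).trace.re ≤ f₂ d δ * prob (depolarizing d δ) E -
      ∫ ψ, (output (depolarizing d δ) E ψ * pureState ψ).trace.re ∂(haarUnit d) := by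
  have h := (Complex.le_def.1 (blockTrace_nonneg hE (posSemidef_certificate_sub d h0 h1))).1
  rw [map_sub, map_sub, map_smul, map_smul, blockTrace_kronecker_one] at h
  simp only [Complex.sub_re, smul_eq_mul, Complex.re_ofReal_mul, Complex.zero_re] at h
  rw [prob_eq_blockTrace, fidelity_numerator_eq_blockTrace]
  linarith

theorem trace_antisym_nonneg {d : ℕ} {E : OpN 2 d →ₗ[ℂ] Op d} (hE : IsCPTN E) :
    0 ≤ (E (1 - symProj 2 d)).trace.re := by
  rw [← blockTrace_kronecker_one]
  exact (Complex.le_def.1 (blockTrace_nonneg hE (posSemidef_kron_one_of_projection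
    (one_sub_symProj_two_isHermitian d) (one_sub_symProj_two_mul_self d)))).1

theorem fidelity_le_f₂ {d : ℕ} [NeZero d] {δ : ℝ} (h0 : 0 ≤ δ) (h1 : δ ≤ 1)
    {E : OpN 2 d →ₗ[ℂ] Op d} (hE : IsCPTN E) (hp : 0 < prob (depolarizing d δ) E) :
    fidelity (depolarizing d δ) E ≤ f₂ d δ := by
  rw [fidelity, div_le_iff₀ hp]
  have := antisymGap_mul_trace_le h0 h1 hE
  have := mul_nonneg (antisymGap_nonneg d h0 h1) (trace_antisym_nonneg hE)
  linarith

theorem prob_le_p₂ {d : ℕ} [NeZero d] {δ : ℝ} (h0 : 0 ≤ δ) (h1 : δ < 1)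
    {E : OpN 2 d →ₗ[ℂ] Op d} (hE : IsCPTN E) (hp : 0 < prob (depolarizing d δ) E)
    (hf : fidelity (depolarizing d δ) E = f₂ d δ) :
    prob (depolarizing d δ) E ≤ p₂ d δ := by
  have hd : (0 : ℝ) < d := by exact_mod_cast NeZero.pos d
  have hb : 0 ≤ 1 - δ := sub_nonneg.2 h1.le
  rw [fidelity, div_eq_iff hp.ne'] at hf
  have hgap := antisymGap_mul_trace_le h0 h1.le hE
  rw [hf, sub_self] at hgap
  have hanti := trace_antisym_nonneg hE
  have hP : (symProj 2 d).PosSemidef := by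
    have := Matrix.posSemidef_conjTranspose_mul_self (symProj 2 d)
    rwa [(symProj_two_isHermitian d).eq, symProj_two_mul_self] at this
  have htr := hE.trace_le _ hP
  rw [trace_symProj_two, Complex.ofReal_re] at htr
  -- Either δ = 0 and the coefficient is zero, or the positive gap forces the trace to be zero. At δ
  -- = 1 the gap vanishes and this argument is unavailable.
  have hzero : (2 * (1 - δ) * (δ / d) / d + (δ / d) ^ 2) *
      (E (1 - symProj 2 d)).trace.re = 0 := by
    rcases h0.eq_or_lt with rfl | h0
    · simp
    · have : (E (1 - symProj 2 d)).trace.re = 0 :=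
        le_antisymm (nonpos_of_mul_nonpos_right hgap (antisymGap_pos d h0 h1)) hanti
      rw [this, mul_zero]
  rw [prob_eq_blockTrace, Rop_eq, map_add, map_smul, map_smul, blockTrace_kronecker_one,
    blockTrace_kronecker_one, Complex.add_re, smul_eq_mul, smul_eq_mul, Complex.re_ofReal_mul,
    Complex.re_ofReal_mul, hzero, add_zero]
  -- The symmetric eigenvalue of R times tr Π₂ = d(d+1)/2 equals p₂.
  refine (mul_le_mul_of_nonneg_left htr (by positivity)).trans_eq ?_
  have h2 := two_mul_p₂ d δ
  generalize p₂ d δ = p at *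
  have ha : δ = d * (δ / d) := by field_simp
  generalize δ / d = a at *
  subst ha
  field_simp
  linear_combination -h2

/-! ### The swap test attains the bounds -/

theorem mul_symProj_two_apply {d : ℕ} {m : Type} (M : Matrix m (Fin 2 → Fin d) ℂ) (i : m)
    (y : Fin 2 → Fin d) :
    (M * symProj 2 d) i y = 2⁻¹ * (M i y + M i ![y 1, y 0]) := by
  have h := symProj_two_mul_apply M.conjTranspose y i
  rw [← (symProj_two_isHermitian d).eq, ← Matrix.conjTranspose_mul, Matrix.conjTranspose_apply] at h
  have h2 := congrArg star h
  simpa using h2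

theorem swapTest_apply (d : ℕ) (ρ : OpN 2 d) :
    swapTest d ρ = ∑ k : Fin d, (symProj 2 d * ρ * (symProj 2 d).conjTranspose).submatrix
      (fun i => ![i, k]) (fun i => ![i, k]) := by
  ext i j
  simp only [Matrix.sum_apply]
  rfl

/-- The ampliation conjugates by 1 ⊗ Π₂ and then sums principal submatrices (the partial trace);
both operations preserve positivity. -/
theorem ampliation_swapTest_posSemidef (d k : ℕ)
    {X : Matrix (Fin k × (Fin 2 → Fin d)) (Fin k × (Fin 2 → Fin d)) ℂ} (hX : X.PosSemidef) :
    (ampliation k (swapTest d) X).PosSemidef := by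
  let K := (1 : Matrix (Fin k) (Fin k) ℂ) ⊗ₖ symProj 2 d
  have hsum : ampliation k (swapTest d) X = ∑ l : Fin d, (K * X * K.conjTranspose).submatrix
      (fun a : Fin k × Fin d => (a.1, ![a.2, l])) (fun a => (a.1, ![a.2, l])) := by
    ext a b
    simp only [Matrix.sum_apply, ampliation, Matrix.of_apply, swapTest_apply,
      Matrix.submatrix_apply]
    refine Finset.sum_congr rfl fun l _ => ?_
    simp only [Matrix.mul_apply, Fintype.sum_prod_type, K, Matrix.conjTranspose_apply,
      Matrix.kroneckerMap_apply, Matrix.one_apply, Matrix.of_apply]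
    simp only [Finset.sum_mul, ite_mul, one_mul, zero_mul, Finset.sum_ite_irrel,
      Finset.sum_const_zero, Finset.sum_ite_eq, Finset.mem_univ, if_true]
    rw [Finset.sum_eq_single b.1 (fun x _ hx => by simp [hx.symm]) (by simp)]
    simp
  rw [hsum]
  exact Matrix.posSemidef_sum _ fun l _ => (hX.mul_mul_conjTranspose_same K).submatrix _

theorem swapTest_isCPTN (d : ℕ) : IsCPTN (swapTest d) where
  completelyPositive k X hX := ampliation_swapTest_posSemidef d k hX
  trace_le ρ hρ := by
    have h1 : (swapTest d ρ).trace = (ρ * symProj 2 d).trace := by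
      have : (swapTest d ρ).trace = (symProj 2 d * ρ * (symProj 2 d).conjTranspose).trace := by
        rw [Matrix.trace, Matrix.trace, sum_fin_two_fun]; rfl
      rw [this, (symProj_two_isHermitian d).eq, Matrix.trace_mul_comm, ← mul_assoc,
        symProj_two_mul_self, Matrix.trace_mul_comm]
    -- The lost trace is that of (1 − Π₂)ρ(1 − Π₂), the rejected branch.
    have h2 := (hρ.mul_mul_conjTranspose_same (1 - symProj 2 d)).trace_nonneg
    rw [(one_sub_symProj_two_isHermitian d).eq, Matrix.trace_mul_comm, ← mul_assoc,
      one_sub_symProj_two_mul_self, Matrix.trace_mul_comm, mul_sub, mul_one,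
      Matrix.trace_sub, ← h1] at h2
    have := (Complex.le_def.1 h2).1
    simp only [Complex.zero_re, Complex.sub_re] at this
    linarith

theorem swapTest_tensorPow {d : ℕ} (M : Op d) :
    swapTest d (tensorPow 2 M) = (2⁻¹ : ℂ) • (M.trace • M + M * M) := by
  ext i j
  rw [swapTest_apply, Matrix.sum_apply]
  simp only [Matrix.submatrix_apply, (symProj_two_isHermitian d).eq, mul_symProj_two_apply,
    symProj_two_mul_apply, tensorPow, Matrix.of_apply, Fin.prod_univ_two, Matrix.cons_val_zero,
    Matrix.cons_val_one]
  simp only [Matrix.smul_apply, Matrix.add_apply, smul_eq_mul, Matrix.mul_apply, Matrix.trace,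
    Matrix.diag_apply, Finset.sum_mul, ← Finset.sum_add_distrib, Finset.mul_sum]
  refine Finset.sum_congr rfl fun k _ => ?_
  ring

theorem pureState_mul_self {d : ℕ} (ψ : UnitVec d) : pureState ψ * pureState ψ = pureState ψ := by
  ext i j
  have h : ∀ k, pureState ψ i k * pureState ψ k j =
      pureState ψ i j * (ψ.1 k * star (ψ.1 k)) := fun k => by
    simp only [pureState_apply]; ring
  rw [Matrix.mul_apply, Finset.sum_congr rfl fun k _ => h k, ← Finset.mul_sum,
    sum_star_mul_self, mul_one]

theorem trace_pureState {d : ℕ} (ψ : UnitVec d) : (pureState ψ).trace = 1 :=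
  sum_star_mul_self ψ

theorem depolarizing_pureState {d : ℕ} (δ : ℝ) (ψ : UnitVec d) :
    depolarizing d δ (pureState ψ) =
      ((1 - δ : ℝ) : ℂ) • pureState ψ + ((δ / d : ℝ) : ℂ) • 1 := by
  ext i j
  rw [depolarizing_pureState_apply, ← op_one_apply]
  rfl

/-- For a trace-one M the swap test returns (M + M²)/2, and ψ is idempotent. The trace and the
overlap with ψ are therefore constant in ψ, and the Haar integrals become trivial. -/
theorem output_swapTest {d : ℕ} [NeZero d] (δ : ℝ) (ψ : UnitVec d) :
    output (depolarizing d δ) (swapTest d) ψ =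
      (((1 - δ + (1 - δ) ^ 2 + 2 * (1 - δ) * (δ / d)) / 2 : ℝ) : ℂ) • pureState ψ +
      (((δ / d + (δ / d) ^ 2) / 2 : ℝ) : ℂ) • 1 := by
  have hd : (d : ℂ) ≠ 0 := by exact_mod_cast NeZero.ne d
  have htr : (depolarizing d δ (pureState ψ)).trace = 1 := by
    rw [depolarizing_pureState, Matrix.trace_add, Matrix.trace_smul, Matrix.trace_smul,
      trace_pureState, Matrix.trace_one, Fintype.card_fin]
    push_cast
    simp only [smul_eq_mul]
    field_simp
    ring
  rw [output, swapTest_tensorPow, htr, depolarizing_pureState]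
  simp only [add_mul, mul_add, Matrix.smul_mul, Matrix.mul_smul, pureState_mul_self, mul_one,
    one_mul]
  push_cast
  module

theorem trace_output_swapTest {d : ℕ} [NeZero d] (δ : ℝ) (ψ : UnitVec d) :
    (output (depolarizing d δ) (swapTest d) ψ).trace.re = p₂ d δ := by
  have hd : (d : ℝ) ≠ 0 := by exact_mod_cast NeZero.ne d
  rw [output_swapTest, Matrix.trace_add, Matrix.trace_smul, Matrix.trace_smul,
    trace_pureState, Matrix.trace_one, Fintype.card_fin, smul_eq_mul, smul_eq_mul, mul_one,
    Complex.add_re, Complex.ofReal_re, Complex.re_ofReal_mul, Complex.natCast_re]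
  have h := two_mul_p₂ d δ
  field_simp at h ⊢
  linear_combination -h

theorem trace_output_swapTest_mul {d : ℕ} [NeZero d] (δ : ℝ) (ψ : UnitVec d) :
    (output (depolarizing d δ) (swapTest d) ψ * pureState ψ).trace.re =
      f₂ d δ * p₂ d δ := by
  rw [output_swapTest, add_mul, Matrix.smul_mul, Matrix.smul_mul, pureState_mul_self, one_mul,
    Matrix.trace_add, Matrix.trace_smul, Matrix.trace_smul, trace_pureState, smul_eq_mul,
    smul_eq_mul, mul_one, mul_one, Complex.add_re, Complex.ofReal_re, Complex.ofReal_re]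
  linear_combination (-1 / 2 : ℝ) * f₂_mul_two_mul_p₂ d δ

theorem prob_swapTest (d : ℕ) [NeZero d] (δ : ℝ) :
    prob (depolarizing d δ) (swapTest d) = p₂ d δ := by
  simp [prob, trace_output_swapTest]

theorem fidelity_swapTest (d : ℕ) [NeZero d] (δ : ℝ) :
    fidelity (depolarizing d δ) (swapTest d) = f₂ d δ := by
  rw [fidelity, prob_swapTest, div_eq_iff (p₂_pos d δ).ne']
  simp [trace_output_swapTest_mul]

theorem achievable_swapTest (d : ℕ) [NeZero d] (δ : ℝ) :
    Achievable (depolarizing d δ) 2 (p₂ d δ) (f₂ d δ) :=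
  ⟨swapTest d, swapTest_isCPTN d, by rw [prob_swapTest]; exact p₂_pos d δ, prob_swapTest d δ,
    fidelity_swapTest d δ⟩

end Purification

theorem theorem1 (d : ℕ) [NeZero d] (δ : ℝ) (hδ0 : 0 ≤ δ) (hδ1 : δ ≤ 1) :
    -- the maximal fidelity for the probability `p₂` is `f₂`
    Purification.IsMaxFidelity (Purification.depolarizing d δ) 2
      (Purification.p₂ d δ) (Purification.f₂ d δ) ∧
    -- the maximal probability for the fidelity `f₂` is `p₂`
    (δ < 1 → Purification.IsMaxProbability (Purification.depolarizing d δ) 2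
      (Purification.f₂ d δ) (Purification.p₂ d δ)) ∧
    -- both values are attained by the swap-test protocol
    (Purification.IsCPTN (Purification.swapTest d) ∧
      Purification.prob (Purification.depolarizing d δ) (Purification.swapTest d) =
        Purification.p₂ d δ ∧
      Purification.fidelity (Purification.depolarizing d δ) (Purification.swapTest d) =
        Purification.f₂ d δ) ∧
    -- the dual certificate is feasible
    (((Purification.f₂ d δ : ℝ) : ℂ) • Purification.Rop (Purification.depolarizing d δ) 2 -
      Purification.partialTransposeLast
        (Purification.Qop (Purification.depolarizing d δ) 2)).PosSemidef := by
  refine ⟨⟨Purification.achievable_swapTest d δ, ?_⟩,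
    fun hδ => ⟨Purification.achievable_swapTest d δ, ?_⟩,
    ⟨Purification.swapTest_isCPTN d, Purification.prob_swapTest d δ,
      Purification.fidelity_swapTest d δ⟩,
    Purification.posSemidef_certificate d hδ0 hδ1⟩
  · rintro g ⟨E, hE, hpos, -, rfl⟩
    exact Purification.fidelity_le_f₂ hδ0 hδ1 hE hpos
  · rintro q ⟨E, hE, hpos, rfl, hf⟩
    exact Purification.prob_le_p₂ hδ0 hδ hE hpos hf
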